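/- Let $G=(V,E)$ be a connected undirected graph, let $\mathcal N$ be a set of $n$ agents with pairwise distinct start vertices, let $\mathcal T\subset V$ be a set of $n$ targets, and let $k\ge 2$ be the communication range. Fix a rule that assigns to vertices $v\neq g$ a neighbour $\mathrm{next}(v,g)$ of $v$ with $\mathrm{dist}(\mathrm{next}(v,g),g)=\mathrm{dist}(v,g)-1$, and a rule for choosing a closest element of a nonempty finite set of vertices to a given vertex (ties broken arbitrarily). Every agent $i$ stores a position, a current target, a priority and a table $TP^i:\mathcal T\to\mathbb N\cup\{-\infty\}$. At time $0$ it stands at its start vertex, its target is an arbitrary $\tau\in\mathcal T$ of its own choice, its priority $pr$ is a natural number (the priorities of different agents being different), and $TP^i[\tau]=pr$, $TP^i[\tau']=-\infty$ for $\tau'\ne\tau$. The TP-SWAP algorithm proceeds in synchronous timesteps. At each timestep every agent $i$ communicates exactly with its connected subgroup $N$, the set of agents that can be reached from $i$ by a chain of agents, consecutive ones being at distance at most $k$ in $G$. It collects the positions $V[j]$, targets $TA[j]$ and priorities $PR[j]$ of all $j\in N$, sets $TP[\tau]:=\max_{j\in N}TP^j[\tau]$ for all $\tau\in\mathcal T$,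 lists $N$ by decreasing priority, and runs TP-UPDATE, that is, the following two loops over this list: 1. For each $j$: if $TP[TA[j]]>PR[j]$, then $TA[j]$ is replaced by a target $\tau'\in\mathcal T$ that is closest to $V[j]$ among those with $TP[\tau']\le PR[j]$, and $TP[\tau']:=PR[j]$. The procedure fails if there is no such $\tau'$. 2. For each $j$ with $V[j]\ne TA[j]$: let $v=\mathrm{next}(V[j],TA[j])$. If no agent $b\in N$ has $V[b]=v$, then $V[j]:=v$. If $V[b]=v$ for some $b\in N$ and $TA[b]=v$, then $j$ and $b$ exchange their targets and their priorities. Otherwise, if $j$ lies in a deadlock, i.e. a cyclic sequence of agents of $N$, none of them at its target, in which the next vertex of each agent is occupied by the following agent, then targets and priorities are rotated along it: each agent of the sequence passes its target and its priority on to the following agent. Agent $i$ then adopts its resulting target $TA[i]$, priority $PR[i]$ and table $TP$, and moves to $V[i]$. Then TP-SWAP is complete: TP-UPDATE never fails (an admissible target always exists), and there is a finite time from which on every agent stands at its own current target and every target in $\mathcal T$ is occupied by some agent. -/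

import Mathlib

namespace TPSwap

/-- The data that one agent stores between two timesteps: its vertex, its current target, its
current priority, and its own target-priority table (`⊥` stands for `-∞`). -/
structure AgentState (V : Type*) where
  pos : V
  tgt : V
  prio : ℕ
  tp : V → WithBot ℕ

/-- The temporary tables on which one call of TP-UPDATE works: positions, targets and priorities
of the agents of the current subgroup, and the merged target-priority table.  Entries of agents
outside the subgroup are never read. -/
structure Tables (A V : Type*) where
  pos : A → V
  tgt : A → V
  prio : A → ℕ
  tp : V → WithBot ℕ

/-- `next v g` is, for `v ≠ g`, the vertex after `v` on a shortest path from `v` to `g`. -/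
def IsNextVertexRule {V : Type*} (G : SimpleGraph V) (next : V → V → V) : Prop :=
  ∀ v g, v ≠ g → G.Adj v (next v g) ∧ G.dist (next v g) g + 1 = G.dist v g

/-- `closest v C` is an element of the nonempty finite set `C` at minimal distance from `v`
(how ties are broken is left open). -/
def IsClosestRule {V : Type*} (G : SimpleGraph V) (closest : V → Finset V → V) : Prop :=
  ∀ v C, C.Nonempty → closest v C ∈ C ∧ ∀ τ ∈ C, G.dist v (closest v C) ≤ G.dist v τ

open Classical in
/-- The connected subgroup of agent `i`: all agents reachable from `i` by a chain of agents,
consecutive ones being at distance at most `k` from each other (`i` itself is included). -/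
noncomputable def subgroup {A V : Type*} [Fintype A] (G : SimpleGraph V) (k : ℕ)
    (c : A → AgentState V) (i : A) : Finset A :=
  Finset.univ.filter fun j =>
    Relation.ReflTransGen (fun a b => G.dist (c a).pos (c b).pos ≤ k) i j

/-- The tables an agent obtains by communicating with the agents of `N`; in the merged
target-priority table every target gets the largest value recorded by an agent of `N`. -/
noncomputable def gather {A V : Type*} (c : A → AgentState V) (N : Finset A) : Tables A V where
  pos j := (c j).pos
  tgt j := (c j).tgt
  prio j := (c j).prio
  tp τ := N.sup fun j => (c j).tp τ

/-- The agents of `N`, sorted by decreasing priority. -/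
noncomputable def sortByPriority {A : Type*} (N : Finset A) (prio : A → ℕ) : List A :=
  N.toList.mergeSort fun a b => decide (prio b ≤ prio a)

open Classical in
/-- One pass of the first loop of TP-UPDATE, for agent `j`.  If the table says that the target of
`j` is claimed with a higher priority, then `j` takes the closest target that is not, and records
its priority there.  The value is `none` (failure) if there is no such target. -/
noncomputable def resolveOne {A V : Type*} (T : Finset V) (closest : V → Finset V → V)
    (S : Tables A V) (j : A) : Option (Tables A V) :=
  if (S.prio j : WithBot ℕ) < S.tp (S.tgt j) then
    let C := T.filter fun τ => S.tp τ ≤ (S.prio j : WithBot ℕ)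
    let τ' := closest (S.pos j) C
    if C.Nonempty then
      some { S with
        tgt := Function.update S.tgt j τ'
        tp := Function.update S.tp τ' (S.prio j : WithBot ℕ) }
    else none
  else some S

/-- Exchange of targets together with priorities: agent `σ a` receives those of agent `a`. -/
def Tables.permute {A V : Type*} (S : Tables A V) (σ : Equiv.Perm A) : Tables A V :=
  { S with
    tgt := fun a => S.tgt (σ.symm a)
    prio := fun a => S.prio (σ.symm a) }

open Classical in
/-- The agent of the list `N` that stands at `v`, if there is one. -/
noncomputable def occupant {A V : Type*} (N : List A) (S : Tables A V) (v : V) : Option A :=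
  N.find? fun b => decide (S.pos b = v)

open Classical in
/-- The agent of `N` that stands at the next vertex of `a`, if `a` is not at its target and there
is such an agent. -/
noncomputable def blocker {A V : Type*} (next : V → V → V) (N : List A) (S : Tables A V) (a : A) :
    Option A :=
  if S.pos a = S.tgt a then none else occupant N S (next (S.pos a) (S.tgt a))

open Classical in
/-- Follow `f` from `a` until the agent `j` is reached, for at most the given number of steps;
the list of the agents visited before `j`, or `none` if `j` is not reached. -/
noncomputable def followTo {A : Type*} (f : A → Option A) (j : A) : ℕ → A → Option (List A)
  | 0, _ => none
  | m + 1, a =>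
    match f a with
    | none => none
    | some b => if b = j then some [a] else (followTo f j m b).map fun D => a :: D

/-- The deadlock that contains `j`: a list `[j, a₁, …, aₘ]` of agents of `N` in which each agent's
next vertex is occupied by the following one and that of the last one is occupied by `j`; `none` if
`j` is not in a deadlock. -/
noncomputable def deadlock {A V : Type*} (next : V → V → V) (N : List A) (S : Tables A V) (j : A) :
    Option (List A) :=
  followTo (blocker next N S) j N.length j

open Classical in
/-- One pass of the second loop of TP-UPDATE, for agent `j`.  In a deadlock `[a₀, …, aₘ]`
the agent `aᵢ₊₁`, which occupies the next vertex of `aᵢ`, receives the target and the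
priority of `aᵢ`, cyclically (`List.formPerm` maps `aᵢ` to `aᵢ₊₁`). -/
noncomputable def tswapOne {A V : Type*} (next : V → V → V) (N : List A) (S : Tables A V) (j : A) :
    Tables A V :=
  if S.pos j = S.tgt j then S
  else
    let v := next (S.pos j) (S.tgt j)
    match occupant N S v with
    | some b =>
      if v = S.tgt b then S.permute (Equiv.swap j b)
      else
        match deadlock next N S j with
        | some D => S.permute D.formPerm
        | none => S
    | none => { S with pos := Function.update S.pos j v }

/-- TP-UPDATE on the subgroup `N` with tables `S`; `none` if an agent that has to abandon its
target finds no admissible one. -/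
noncomputable def tpUpdate {A V : Type*} (T : Finset V) (next : V → V → V)
    (closest : V → Finset V → V) (N : Finset A) (S : Tables A V) : Option (Tables A V) :=
  let L := sortByPriority N S.prio
  (L.foldlM (resolveOne T closest) S).map fun S' => L.foldl (tswapOne next L) S'

/-- One iteration of the main loop as carried out by agent `i`: it communicates with its
connected subgroup, runs TP-UPDATE on what it has learned, and adopts its own entries. -/
noncomputable def agentStep {A V : Type*} [Fintype A] (G : SimpleGraph V) (k : ℕ) (T : Finset V)
    (next : V → V → V) (closest : V → Finset V → V) (c : A → AgentState V) (i : A) :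
    Option (AgentState V) :=
  let N := subgroup G k c i
  (tpUpdate T next closest N (gather c N)).map fun S =>
    { pos := S.pos i, tgt := S.tgt i, prio := S.prio i, tp := S.tp }

open Classical in
/-- One synchronous timestep of all agents; `none` if the step of some agent fails. -/
noncomputable def globalStep {A V : Type*} [Fintype A] (G : SimpleGraph V) (k : ℕ) (T : Finset V)
    (next : V → V → V) (closest : V → Finset V → V) (c : A → AgentState V) :
    Option (A → AgentState V) :=
  if h : ∀ i, (agentStep G k T next closest c i).isSome then
    some fun i => (agentStep G k T next closest c i).get (h i)
  else none

open Classical in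
/-- The initial configuration: agent `i` is at its start vertex `s i`, heads for the target `τ₀ i`
with priority `pr₀ i`, and knows only of its own choice. -/
noncomputable def initial {A V : Type*} (s τ₀ : A → V) (pr₀ : A → ℕ) : A → AgentState V :=
  fun i =>
    { pos := s i
      tgt := τ₀ i
      prio := pr₀ i
      tp := Function.update (fun _ => ⊥) (τ₀ i) (pr₀ i : WithBot ℕ) }

/-- The configuration at time `t` of the execution of TP-SWAP; `none` if some call of TP-UPDATE
failed before. -/
noncomputable def run {A V : Type*} [Fintype A] (G : SimpleGraph V) (k : ℕ) (T : Finset V)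
    (next : V → V → V) (closest : V → Finset V → V) (s τ₀ : A → V) (pr₀ : A → ℕ) :
    ℕ → Option (A → AgentState V)
  | 0 => some (initial s τ₀ pr₀)
  | t + 1 => (run G k T next closest s τ₀ pr₀ t).bind (globalStep G k T next closest)

end TPSwap

namespace TPSwap

/-! No failure: in the merged table of a subgroup no priority is recorded at two targets, and an
agent's priority is recorded at most at its own target. If no target were admissible for `j`, the
`n` targets would carry distinct priorities above that of `j`, but at most `n - 1` priorities differ
from it (`Consistent.exists_admissible`). Merged tables have this property although subgroups hold
different information: by `Invariant`, of two agents that record the same priority at different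
targets, at least one knows a higher value at the other's target, so taking maxima erases a record.
`resolveOne_spec` and `Invariant.step` propagate this.

Termination: the pair (`slack`, total `load`) decreases lexicographically. Tables only grow, within
a finite range. If no table changes in a timestep, the first loop changed no target, and the second
loop acts on fixed targets. Moves and deadlock rotations shorten the total distance; an exchange
with an agent at its target preserves it but leaves one agent fewer at its target. The load `K *
distance + (number at target)`, with `K` above the number of agents, drops in each case. If the
second loop does nothing, no agent is away from its target: otherwise such agents would block one
another in a cycle, which is a deadlock and would be rotated (`atTarget_of_foldl_tswapOne_eq`). The
state is then fixed, and since positions stay distinct, counting shows that all targets are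
occupied. -/

variable {A V : Type*}

/-! ### The first loop: consistency of the merged table -/

/-- The properties of the tables of a subgroup `N` that the first loop of TP-UPDATE maintains:
in particular no priority is recorded at two targets, and the priority of an agent of `N` is
recorded at most at its current target. -/
structure Consistent (P : Finset ℕ) (T : Finset V) (N : Finset A) (S : Tables A V) : Prop where
  prio_inj : Set.InjOn S.prio N
  prio_mem : ∀ j ∈ N, S.prio j ∈ P
  tgt_mem : ∀ j ∈ N, S.tgt j ∈ T
  le_tp : ∀ j ∈ N, (S.prio j : WithBot ℕ) ≤ S.tp (S.tgt j)
  tp_mem : ∀ (τ : V) (q : ℕ), S.tp τ = q → q ∈ P ∧ τ ∈ T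
  tp_inj : ∀ (τ τ' : V) (q : ℕ), S.tp τ = q → S.tp τ' = q → τ = τ'
  eq_tgt : ∀ j ∈ N, ∀ τ : V, S.tp τ = S.prio j → τ = S.tgt j

/-- How the tables `S'` at some point of the first loop are related to the initial ones. -/
structure Resolves (N : Finset A) (S S' : Tables A V) : Prop where
  pos_eq : S'.pos = S.pos
  prio_eq : S'.prio = S.prio
  tp_le : ∀ τ, S.tp τ ≤ S'.tp τ
  tp_eq_or : ∀ τ, S'.tp τ = S.tp τ ∨
    ∃ j ∈ N, S'.tgt j = τ ∧ S'.tp τ = S.prio j ∧ (S.prio j : WithBot ℕ) < S'.tp (S.tgt j)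
  tgt_eq_or : ∀ j, S'.tgt j = S.tgt j ∨ (S.prio j : WithBot ℕ) < S'.tp (S.tgt j)

theorem Resolves.refl (N : Finset A) (S : Tables A V) : Resolves N S S :=
  ⟨rfl, rfl, fun _ => le_rfl, fun _ => Or.inl rfl, fun _ => Or.inl rfl⟩

/-- An admissible target exists, because the targets that are recorded with a higher priority
than that of `j` carry pairwise distinct priorities, none of which is that of `j`. -/
theorem Consistent.exists_admissible {P : Finset ℕ} {T : Finset V} {N : Finset A}
    {S : Tables A V} (h : Consistent P T N S) (hPT : P.card ≤ T.card) {j : A} (hj : j ∈ N) :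
    ∃ τ ∈ T, S.tp τ ≤ (S.prio j : WithBot ℕ) := by
  by_contra! hlt
  have hval : ∀ τ ∈ T, ∃ q : ℕ, S.tp τ = q := fun τ hτ => by
    obtain ⟨q, hq⟩ := WithBot.ne_bot_iff_exists.1 (ne_bot_of_gt (hlt τ hτ))
    exact ⟨q, hq.symm⟩
  choose! f hf using hval
  have hcard : T.card ≤ (P.erase (S.prio j)).card := by
    refine Finset.card_le_card_of_injOn f (fun τ hτ => ?_) fun τ hτ τ' hτ' hff => ?_
    · have h1 := hlt τ hτ
      rw [hf τ hτ] at h1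
      exact Finset.mem_coe.2 (Finset.mem_erase.2
        ⟨(WithBot.coe_lt_coe.1 h1).ne', (h.tp_mem τ _ (hf τ hτ)).1⟩)
    · exact h.tp_inj τ τ' _ (hf τ hτ) (hff ▸ hf τ' hτ')
  have := Finset.card_erase_lt_of_mem (h.prio_mem j hj)
  omega

/-- A new record overwrites only a value at most the priority of `j`, so the records of agents with
higher priority survive. This is why the loop runs by decreasing priority. -/
theorem resolveOne_spec {P : Finset ℕ} {T : Finset V} {N : Finset A} {G : SimpleGraph V}
    {closest : V → Finset V → V} (hclosest : IsClosestRule G closest) (hPT : P.card ≤ T.card)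
    {S S₁ : Tables A V} (h : Consistent P T N S₁) (hR : Resolves N S S₁) {j : A} (hj : j ∈ N) :
    ∃ S₂, resolveOne T closest S₁ j = some S₂ ∧ Consistent P T N S₂ ∧ Resolves N S S₂ ∧
      S₂.tp (S₂.tgt j) = S.prio j ∧
      ∀ a ∈ N, S.prio j < S.prio a → S₁.tp (S₁.tgt a) = S.prio a →
        S₂.tp (S₂.tgt a) = S.prio a := by
  classical
  by_cases hlt : (S₁.prio j : WithBot ℕ) < S₁.tp (S₁.tgt j)
  swap
  · refine ⟨S₁, by simp [resolveOne, hlt], h, hR, ?_, fun a _ _ ha => ha⟩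
    rw [← hR.prio_eq]
    exact le_antisymm (not_lt.1 hlt) (h.le_tp j hj)
  obtain ⟨τ₁, hτ₁, hle₁⟩ := h.exists_admissible hPT hj
  set C := T.filter fun τ => S₁.tp τ ≤ (S₁.prio j : WithBot ℕ) with hC
  have hne : C.Nonempty := ⟨τ₁, by simp [hC, hτ₁, hle₁]⟩
  obtain ⟨hmem, -⟩ := hclosest (S₁.pos j) C hne
  set τ' := closest (S₁.pos j) C with hτ'
  obtain ⟨hτT, hτle⟩ : τ' ∈ T ∧ S₁.tp τ' ≤ (S₁.prio j : WithBot ℕ) := by simpa [hC] using hmem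
  set S₂ : Tables A V := { S₁ with
        tgt := Function.update S₁.tgt j τ'
        tp := Function.update S₁.tp τ' (S₁.prio j : WithBot ℕ) } with hS₂
  have hres : resolveOne T closest S₁ j = some S₂ := by
    simp only [resolveOne, hlt, if_true]
    rw [if_pos]
    convert hne
  have hprio : S₂.prio = S₁.prio := rfl
  have tgt_self : S₂.tgt j = τ' := by simp [hS₂]
  have tgt_ne : ∀ a, a ≠ j → S₂.tgt a = S₁.tgt a := fun a ha => by simp [hS₂, ha]
  have tp_self : S₂.tp τ' = (S₁.prio j : WithBot ℕ) := by simp [hS₂]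
  have tp_ne : ∀ τ, τ ≠ τ' → S₂.tp τ = S₁.tp τ := fun τ hτ => by simp [hS₂, hτ]
  have tp_le : ∀ τ, S₁.tp τ ≤ S₂.tp τ := fun τ => by
    by_cases hτ : τ = τ'
    · rw [hτ, tp_self]; exact hτle
    · rw [tp_ne τ hτ]
  -- The priority of `j` could only be recorded at the target of `j`, where a higher value stands;
  -- hence the new record is its only one.
  have not_rec : ∀ τ, S₁.tp τ ≠ (S₁.prio j : WithBot ℕ) := fun τ hτ => by
    have := h.eq_tgt j hj τ hτ
    rw [← this, hτ] at hlt
    exact lt_irrefl _ hlt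
  -- `Resolves` refers to the target of `j` before the loop: it is either still the current one or
  -- was already abandoned.
  have hkey : (S.prio j : WithBot ℕ) < S₂.tp (S.tgt j) := by
    refine lt_of_lt_of_le ?_ (tp_le _)
    rcases hR.tgt_eq_or j with h1 | h1
    · rw [← h1, ← hR.prio_eq]; exact hlt
    · exact h1
  refine ⟨S₂, hres, ?_, ?_, ?_, ?_⟩
  · refine ⟨h.prio_inj, h.prio_mem, fun a ha => ?_, fun a ha => ?_, fun τ q hq => ?_,
      fun τ τ'' q hq hq' => ?_, fun a ha τ hτ => ?_⟩
    · by_cases haj : a = j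
      · rw [haj, tgt_self]; exact hτT
      · rw [tgt_ne a haj]; exact h.tgt_mem a ha
    · by_cases haj : a = j
      · rw [haj, tgt_self, tp_self]
      · rw [tgt_ne a haj]; exact (h.le_tp a ha).trans (tp_le _)
    · by_cases hτ : τ = τ'
      · rw [hτ, tp_self, Nat.cast_inj] at hq
        rw [hτ, ← hq]
        exact ⟨h.prio_mem j hj, hτT⟩
      · rw [tp_ne τ hτ] at hq; exact h.tp_mem τ q hq
    · by_cases h1 : τ = τ' <;> by_cases h2 : τ'' = τ'
      · rw [h1, h2]
      · rw [h1, tp_self] at hq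
        rw [tp_ne _ h2, ← hq] at hq'
        exact absurd hq' (not_rec _)
      · rw [h2, tp_self] at hq'
        rw [tp_ne _ h1, ← hq'] at hq
        exact absurd hq (not_rec _)
      · rw [tp_ne _ h1] at hq
        rw [tp_ne _ h2] at hq'
        exact h.tp_inj τ τ'' q hq hq'
    · rw [hprio] at hτ
      by_cases haj : a = j
      · rw [haj, tgt_self]
        by_contra hne'
        rw [tp_ne τ hne', haj] at hτ
        exact not_rec _ hτ
      · rw [tgt_ne a haj]
        by_cases h1 : τ = τ'
        · rw [h1, tp_self, Nat.cast_inj] at hτ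
          exact absurd (h.prio_inj hj ha hτ).symm haj
        · rw [tp_ne τ h1] at hτ
          exact h.eq_tgt a ha τ hτ
  · refine ⟨hR.pos_eq, hR.prio_eq, fun τ => (hR.tp_le τ).trans (tp_le τ), fun τ => ?_,
      fun a => ?_⟩
    · by_cases h1 : τ = τ'
      · exact Or.inr ⟨j, hj, tgt_self.trans h1.symm, by rw [h1, tp_self, hR.prio_eq], hkey⟩
      · rw [tp_ne τ h1]
        refine (hR.tp_eq_or τ).imp_right ?_
        rintro ⟨a, ha, hat, hap, hal⟩
        have haj : a ≠ j := by
          rintro rfl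
          rw [← hR.prio_eq] at hap
          exact not_rec _ hap
        exact ⟨a, ha, by rw [tgt_ne a haj, hat], hap, hal.trans_le (tp_le _)⟩
    · by_cases haj : a = j
      · rw [haj]; exact Or.inr hkey
      · rw [tgt_ne a haj]
        exact (hR.tgt_eq_or a).imp_right fun h1 => h1.trans_le (tp_le _)
  · rw [tgt_self, tp_self, hR.prio_eq]
  · intro a ha hlta hrec
    have haj : a ≠ j := by rintro rfl; exact lt_irrefl _ hlta
    rw [tgt_ne a haj, tp_ne, hrec]
    intro heq
    rw [← heq, hrec, hR.prio_eq, Nat.cast_le] at hτle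
    omega

/-- `D` collects the agents already processed, all of higher priority than those in `l`. -/
theorem foldlM_resolveOne_spec {P : Finset ℕ} {T : Finset V} {N : Finset A} {G : SimpleGraph V}
    {closest : V → Finset V → V} (hclosest : IsClosestRule G closest) (hPT : P.card ≤ T.card)
    {S : Tables A V} (l : List A) (D : Finset A) (hl : ∀ j ∈ l, j ∈ N)
    (hsort : l.Pairwise fun a b => S.prio b < S.prio a) (hD : D ⊆ N)
    (hDl : ∀ d ∈ D, ∀ a ∈ l, S.prio a < S.prio d) {S₁ : Tables A V}
    (h : Consistent P T N S₁) (hR : Resolves N S S₁)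
    (hrec : ∀ d ∈ D, S₁.tp (S₁.tgt d) = S.prio d) :
    ∃ S₂, l.foldlM (resolveOne T closest) S₁ = some S₂ ∧ Consistent P T N S₂ ∧
      Resolves N S S₂ ∧ ∀ d, d ∈ D ∨ d ∈ l → S₂.tp (S₂.tgt d) = S.prio d := by
  classical
  induction l generalizing D S₁ with
  | nil => exact ⟨S₁, rfl, h, hR, by simpa using hrec⟩
  | cons j l ih =>
    rw [List.pairwise_cons] at hsort
    obtain ⟨S₂, h1, h2, h3, h4, h5⟩ :=
      resolveOne_spec hclosest hPT h hR (hl j List.mem_cons_self)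
    obtain ⟨S₃, g1, g2, g3, g4⟩ := ih (insert j D) (fun a ha => hl a (List.mem_cons_of_mem _ ha))
      hsort.2 (Finset.insert_subset (hl j List.mem_cons_self) hD)
      (by
        intro d hd a ha
        rcases Finset.mem_insert.1 hd with rfl | hd
        · exact hsort.1 a ha
        · exact hDl d hd a (List.mem_cons_of_mem _ ha)) h2 h3
      (by
        intro d hd
        rcases Finset.mem_insert.1 hd with rfl | hd
        · exact h4
        · exact h5 d (hD hd) (hDl d hd j List.mem_cons_self) (hrec d hd))
    refine ⟨S₃, ?_, g2, g3, fun d hd => g4 d ?_⟩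
    · rw [List.foldlM_cons, h1]; exact g1
    · rw [List.mem_cons] at hd
      rw [Finset.mem_insert]
      tauto

theorem mem_sortByPriority {N : Finset A} {prio : A → ℕ} {a : A} :
    a ∈ sortByPriority N prio ↔ a ∈ N := by
  simp [sortByPriority, List.mem_mergeSort]

theorem nodup_sortByPriority (N : Finset A) (prio : A → ℕ) : (sortByPriority N prio).Nodup :=
  (List.mergeSort_perm _ _).nodup_iff.2 N.nodup_toList

theorem pairwise_sortByPriority {N : Finset A} {prio : A → ℕ} (h : Set.InjOn prio N) :
    (sortByPriority N prio).Pairwise fun a b => prio b < prio a := by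
  have h1 : (sortByPriority N prio).Pairwise fun a b => decide (prio b ≤ prio a) = true :=
    List.pairwise_mergeSort (by simpa using fun a b c h1 h2 => le_trans h2 h1)
      (by simpa using fun a b => le_total _ _) _
  refine List.Pairwise.imp_of_mem ?_ (h1.and (nodup_sortByPriority N prio))
  intro a b ha hb hab
  refine lt_of_le_of_ne (by simpa using hab.1) fun heq => hab.2 ?_
  exact (h (mem_sortByPriority.1 hb) (mem_sortByPriority.1 ha) heq).symm

/-- If the first loop does not change the table, then it does not change any target. -/
theorem Consistent.tgt_eq {P : Finset ℕ} {T : Finset V} {N : Finset A} {S S' : Tables A V}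
    (h : Consistent P T N S) (htp : S'.tp = S.tp)
    (hrec : ∀ j ∈ N, S'.tp (S'.tgt j) = S.prio j) {j : A} (hj : j ∈ N) : S'.tgt j = S.tgt j :=
  h.eq_tgt j hj _ (htp ▸ hrec j hj)


/-! ### Cycles of a partial function, for deadlocks -/

theorem isChain_of_followTo {f : A → Option A} {j : A} {m : ℕ} {a : A} {D : List A}
    (h : followTo f j m a = some D) :
    ∃ D', D = a :: D' ∧ j ∉ D' ∧ (D ++ [j]).IsChain fun x y => f x = some y := by
  induction m generalizing a D with
  | zero => simp [followTo] at h
  | succ m ih =>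
    rw [followTo] at h
    cases hf : f a with
    | none => simp [hf] at h
    | some b =>
      simp only [hf] at h
      by_cases hb : b = j
      · rw [if_pos hb, Option.some_inj] at h
        subst h
        exact ⟨[], rfl, List.not_mem_nil, by simp [hf, hb]⟩
      · rw [if_neg hb, Option.map_eq_some_iff] at h
        obtain ⟨D₁, h1, rfl⟩ := h
        obtain ⟨D₂, rfl, h3, h4⟩ := ih h1
        exact ⟨b :: D₂, rfl, by simp [h3, Ne.symm hb], by simpa [hf] using h4⟩

theorem isChain_tail_unique {f : A → Option A} {j : A} {l₁ l₂ : List A} {a : A}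
    (h₁ : (a :: l₁ ++ [j]).IsChain fun x y => f x = some y)
    (h₂ : (a :: l₂ ++ [j]).IsChain fun x y => f x = some y)
    (hj₁ : j ∉ l₁) (hj₂ : j ∉ l₂) : l₁ = l₂ := by
  induction l₁ generalizing a l₂ with
  | nil =>
    cases l₂ with
    | nil => rfl
    | cons c l₂ =>
      simp only [List.cons_append, List.nil_append, List.isChain_cons_cons] at h₁ h₂
      have := h₁.1.symm.trans h₂.1
      simp_all
  | cons b l₁ ih =>
    cases l₂ with
    | nil =>
      simp only [List.cons_append, List.nil_append, List.isChain_cons_cons] at h₁ h₂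
      have := h₁.1.symm.trans h₂.1
      simp_all
    | cons c l₂ =>
      simp only [List.cons_append, List.isChain_cons_cons] at h₁ h₂
      have hbc : b = c := Option.some_inj.1 (h₁.1.symm.trans h₂.1)
      subst hbc
      rw [ih h₁.2 h₂.2 (fun h => hj₁ (List.mem_cons_of_mem _ h))
        (fun h => hj₂ (List.mem_cons_of_mem _ h))]

/-- A repeated agent would have two chains to `j` of different lengths, whereas the orbit up to the
first visit of `j` is determined by its start. -/
theorem nodup_of_isChain {f : A → Option A} {j : A} {l : List A} {a : A}
    (h : (a :: l ++ [j]).IsChain fun x y => f x = some y) (hj : j ∉ l) : (a :: l).Nodup := by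
  induction l generalizing a with
  | nil => simp
  | cons b l ih =>
    have htail : (b :: l ++ [j]).IsChain fun x y => f x = some y := by
      simp only [List.cons_append, List.isChain_cons_cons] at h
      exact h.2
    refine List.nodup_cons.2 ⟨fun hmem => ?_, ih htail fun h => hj (List.mem_cons_of_mem _ h)⟩
    obtain ⟨s, t, hst⟩ := List.append_of_mem hmem
    have hsuf : (a :: t ++ [j]).IsChain fun x y => f x = some y := by
      rw [hst, List.append_assoc] at htail
      exact (List.isChain_append.1 htail).2.1
    have hjt : j ∉ t := fun h' => hj (hst ▸ List.mem_append_right s (List.mem_cons_of_mem _ h'))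
    have := congrArg List.length (isChain_tail_unique h hsuf hj hjt)
    have hlen := congrArg List.length hst
    simp at this hlen
    omega

/-- A list returned by `followTo` that starts at `j` is a cycle of `f`, and its cyclic
permutation agrees with `f`. -/
theorem formPerm_of_followTo {f : A → Option A} {j : A} {m : ℕ} {D : List A} [DecidableEq A]
    (h : followTo f j m j = some D) :
    j ∈ D ∧ ∀ a ∈ D, f a = some (D.formPerm a) := by
  obtain ⟨D', rfl, hj, hchain⟩ := isChain_of_followTo h
  have hnd := nodup_of_isChain hchain hj
  refine ⟨List.mem_cons_self, fun a ha => ?_⟩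
  obtain ⟨i, hi, rfl⟩ := List.getElem_of_mem ha
  rw [List.formPerm_apply_getElem _ hnd i hi]
  have hi' : i + 1 < (j :: D' ++ [j]).length := by simp at hi ⊢; omega
  have := List.isChain_iff_getElem.1 hchain i hi'
  rw [List.getElem_append_left hi] at this
  rw [this, Option.some_inj]
  by_cases hlast : i + 1 < (j :: D').length
  · rw [List.getElem_append_left hlast]
    simp only [Nat.mod_eq_of_lt hlast]
  · have heq : i + 1 = (j :: D').length := by omega
    rw [List.getElem_append_right (by omega)]
    simp only [heq, Nat.mod_self]
    simp

theorem followTo_ne_none {f : A → Option A} {g : A → A} {j : A} {B : Set A}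
    (hg : ∀ a ∈ B, g a ∈ B) (hf : ∀ a ∈ B, f a = some (g a)) {m r : ℕ} {a : A} (ha : a ∈ B)
    (hr : 0 < r) (hrm : r ≤ m) (hj : g^[r] a = j) : followTo f j m a ≠ none := by
  induction m generalizing a r with
  | zero => omega
  | succ m ih =>
    rw [followTo]
    -- The orbit may meet `j` before step `r`; the search then stops earlier.
    simp only [hf a ha]
    by_cases hb : g a = j
    · simp [hb]
    · obtain ⟨r, rfl⟩ : ∃ r', r = r' + 1 := ⟨r - 1, by omega⟩
      rw [Function.iterate_succ_apply] at hj
      rw [if_neg hb, Ne, Option.map_eq_none_iff]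
      refine ih (hg a ha) (Nat.pos_of_ne_zero ?_) (by omega) hj
      rintro rfl
      exact hb hj

/-- A function that maps a nonempty finite set to itself has a cycle. -/
theorem exists_followTo_ne_none {f : A → Option A} {B : Finset A} (hB : B.Nonempty)
    (hf : ∀ a ∈ B, ∃ b ∈ B, f a = some b) {m : ℕ} (hm : B.card ≤ m) :
    ∃ j ∈ B, followTo f j m j ≠ none := by
  classical
  choose! g hgB hfg using hf
  obtain ⟨x, hx⟩ := hB
  have hit : ∀ r, g^[r] x ∈ B := fun r => by
    induction r with
    | zero => exact hx
    | succ r ih => rw [Function.iterate_succ_apply']; exact hgB _ ih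
  -- Among the iterates `0, …, |B|` two coincide, so the earlier one returns to itself within `|B| ≤
  -- m` steps.
  obtain ⟨p, hp, q, hq, hne, heq⟩ := Finset.exists_ne_map_eq_of_card_lt_of_maps_to
    (s := Finset.range (B.card + 1)) (t := B) (f := fun r => g^[r] x) (by simp)
    (fun r _ => hit r)
  wlog hlt : p < q generalizing p q
  · exact this q hq p hp hne.symm heq.symm (by omega)
  rw [Finset.mem_range] at hp hq
  refine ⟨g^[p] x, hit p, followTo_ne_none (g := g) (B := B) hgB hfg (hit p) (r := q - p)
    (by omega) (by omega) ?_⟩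
  rw [← Function.iterate_add_apply, Nat.sub_add_cancel hlt.le]
  exact heq.symm

theorem mem_of_occupant {L : List A} {S : Tables A V} {v : V} {b : A}
    (h : occupant L S v = some b) : b ∈ L ∧ S.pos b = v :=
  ⟨List.mem_of_find?_eq_some h, by simpa using List.find?_some h⟩

theorem blocker_eq_some {next : V → V → V} {L : List A} {S : Tables A V} {a b : A}
    (h : blocker next L S a = some b) :
    b ∈ L ∧ S.pos a ≠ S.tgt a ∧ S.pos b = next (S.pos a) (S.tgt a) := by
  unfold blocker at h
  split_ifs at h with h1
  exact ⟨(mem_of_occupant h).1, h1, (mem_of_occupant h).2⟩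

/-! ### The potential under moves, exchanges and rotations -/

/-- The potential of an agent at `x` heading for `y`. -/
noncomputable def load (G : SimpleGraph V) (K : ℕ) (x y : V) : ℕ :=
  open Classical in K * G.dist x y + if x = y then 1 else 0

open Classical in
theorem sum_load (G : SimpleGraph V) (K : ℕ) (N : Finset A) (x y : A → V) :
    ∑ a ∈ N, load G K (x a) (y a) =
      K * ∑ a ∈ N, G.dist (x a) (y a) + (N.filter fun a => x a = y a).card := by
  simp only [load, Finset.sum_add_distrib, Finset.mul_sum, Finset.card_filter]

/-- The number of agents at their targets is at most `N.card < K`, so it cannot outweigh a unit of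
distance. -/
theorem sum_load_lt_of_dist_lt {G : SimpleGraph V} {K : ℕ} {N : Finset A} (hK : N.card < K)
    {x y x' y' : A → V}
    (h : ∑ a ∈ N, G.dist (x a) (y a) < ∑ a ∈ N, G.dist (x' a) (y' a)) :
    ∑ a ∈ N, load G K (x a) (y a) < ∑ a ∈ N, load G K (x' a) (y' a) := by
  classical
  rw [sum_load, sum_load]
  have h1 := Finset.card_filter_le N fun a => x a = y a
  have h2 := Nat.mul_le_mul_left K (Nat.succ_le_of_lt h)
  rw [Nat.mul_succ] at h2
  omega

theorem sum_load_permute (G : SimpleGraph V) (K : ℕ) {N : Finset A} {σ : Equiv.Perm A}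
    (hσ : ∀ a, σ a ∈ N ↔ a ∈ N) (S : Tables A V) :
    ∑ a ∈ N, load G K ((S.permute σ).pos a) ((S.permute σ).tgt a) =
      ∑ a ∈ N, load G K (S.pos (σ a)) (S.tgt a) := by
  symm
  refine Finset.sum_equiv σ (fun a => (hσ a).symm) fun a _ => ?_
  simp [Tables.permute]

/-- Each affected target passes to an agent one step closer to it. The alternative `a = j`
guarantees a strict decrease without first showing that `σ` is not the identity. -/
theorem sum_load_permute_lt {G : SimpleGraph V} {K : ℕ} {N : Finset A} (hK : N.card < K)
    {next : V → V → V} (hnext : IsNextVertexRule G next) {σ : Equiv.Perm A}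
    (hσ : ∀ a, σ a ∈ N ↔ a ∈ N) {S : Tables A V} {j : A} (hj : j ∈ N)
    (hne : ∀ a, σ a ≠ a ∨ a = j → S.pos a ≠ S.tgt a ∧ S.pos (σ a) = next (S.pos a) (S.tgt a)) :
    ∑ a ∈ N, load G K ((S.permute σ).pos a) ((S.permute σ).tgt a) <
      ∑ a ∈ N, load G K (S.pos a) (S.tgt a) := by
  rw [sum_load_permute G K hσ]
  have hlt : ∀ a, σ a ≠ a ∨ a = j →
      G.dist (S.pos (σ a)) (S.tgt a) < G.dist (S.pos a) (S.tgt a) := fun a ha => by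
    obtain ⟨h1, h2⟩ := hne a ha
    have := (hnext _ _ h1).2
    rw [h2]
    omega
  refine sum_load_lt_of_dist_lt (x := fun a => S.pos (σ a)) hK
    (Finset.sum_lt_sum (fun a _ => ?_) ⟨j, hj, hlt j (Or.inr rfl)⟩)
  by_cases h : σ a = a
  · rw [h]
  · exact (hlt a (Or.inl h)).le

open Classical in
/-- Exchange with an agent that stands at its target: the sum of the distances is the same, but
there is one agent less at its target. -/
theorem sum_load_swap_lt {G : SimpleGraph V} (K : ℕ) {N : Finset A} {next : V → V → V}
    (hnext : IsNextVertexRule G next) {S : Tables A V} {j b : A} (hj : j ∈ N) (hb : b ∈ N)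
    (htgt : Set.InjOn S.tgt N) (hne : S.pos j ≠ S.tgt j)
    (hpos : S.pos b = next (S.pos j) (S.tgt j)) (hat : S.pos b = S.tgt b) :
    ∑ a ∈ N, load G K ((S.permute (Equiv.swap j b)).pos a) ((S.permute (Equiv.swap j b)).tgt a) <
      ∑ a ∈ N, load G K (S.pos a) (S.tgt a) := by
  have hjb : j ≠ b := by rintro rfl; exact hne hat
  have hswap : ∀ a, Equiv.swap j b a ∈ N ↔ a ∈ N := fun a => by
    rw [Equiv.swap_apply_def]
    split_ifs with h1 h2
    · simp [h1, hj, hb]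
    · simp [h2, hj, hb]
    · rfl
  rw [sum_load_permute G K hswap]
  have hsplit : ∀ w : A → ℕ, ∑ a ∈ N, w a = w j + (w b + ∑ a ∈ (N.erase j).erase b, w a) := by
    intro w
    rw [← Finset.add_sum_erase N w hj,
      ← Finset.add_sum_erase (N.erase j) w (Finset.mem_erase.2 ⟨hjb.symm, hb⟩)]
  rw [hsplit, hsplit (fun a => load G K (S.pos a) (S.tgt a))]
  have hrest : ∑ a ∈ (N.erase j).erase b, load G K (S.pos (Equiv.swap j b a)) (S.tgt a) =
      ∑ a ∈ (N.erase j).erase b, load G K (S.pos a) (S.tgt a) := by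
    refine Finset.sum_congr rfl fun a ha => ?_
    rw [Finset.mem_erase, Finset.mem_erase] at ha
    rw [Equiv.swap_apply_of_ne_of_ne ha.2.1 ha.1]
  rw [hrest, Equiv.swap_apply_left, Equiv.swap_apply_right]
  obtain ⟨hadj, hdist⟩ := hnext _ _ hne
  rw [← hpos] at hadj hdist
  have h1 : S.pos b ≠ S.tgt j := fun h => hjb (htgt hj hb (h.symm.trans hat))
  have h2 : S.pos j ≠ S.tgt b := hat ▸ hadj.ne
  have h3 : G.dist (S.pos j) (S.tgt b) = 1 := by
    rw [← hat]; exact SimpleGraph.dist_eq_one_iff_adj.2 hadj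
  have h4 : G.dist (S.pos b) (S.tgt b) = 0 := by rw [hat, SimpleGraph.dist_self]
  -- With `d` the distance from the position of `b` to the target of `j`, the contribution of the
  -- pair falls from `K * (d + 1) + 1` to `K * d + K`.
  simp only [load, if_neg h1, if_neg h2, if_neg hne, if_pos hat, h3, h4, ← hdist, mul_add]
  omega

/-! ### The second loop -/

/-- The relation between the tables of the subgroup `N` before and after some passes of the second
loop of TP-UPDATE in which the agents of the list `l` have their turn. -/
structure Moves (G : SimpleGraph V) (K : ℕ) (N : Finset A) (l : List A) (S S' : Tables A V) :
    Prop where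
  tp_eq : S'.tp = S.tp
  exists_perm : ∃ σ : Equiv.Perm A, (∀ a, σ a ∈ N ↔ a ∈ N) ∧
    (∀ a, S'.tgt (σ a) = S.tgt a) ∧ ∀ a, S'.prio (σ a) = S.prio a
  pos_inj : Set.InjOn S.pos N → Set.InjOn S'.pos N
  pos_eq : ∀ a, a ∉ l → S'.pos a = S.pos a
  dist_le : ∀ a, G.dist (S.pos a) (S'.pos a) ≤ 1
  load_lt : S' = S ∨ ∑ a ∈ N, load G K (S'.pos a) (S'.tgt a) <
    ∑ a ∈ N, load G K (S.pos a) (S.tgt a)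

theorem Moves.refl (G : SimpleGraph V) (K : ℕ) (N : Finset A) (l : List A) (S : Tables A V) :
    Moves G K N l S S :=
  ⟨rfl, ⟨1, by simp, by simp, by simp⟩, id, fun _ _ => rfl, by simp, Or.inl rfl⟩

theorem Moves.permute {G : SimpleGraph V} {K : ℕ} {N : Finset A} {l : List A} {S : Tables A V}
    {σ : Equiv.Perm A} (hσ : ∀ a, σ a ∈ N ↔ a ∈ N)
    (hlt : ∑ a ∈ N, load G K ((S.permute σ).pos a) ((S.permute σ).tgt a) <
      ∑ a ∈ N, load G K (S.pos a) (S.tgt a)) : Moves G K N l S (S.permute σ) :=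
  ⟨rfl, ⟨σ, hσ, by simp [Tables.permute], by simp [Tables.permute]⟩, id, fun _ _ => rfl,
    by simp [Tables.permute], Or.inr hlt⟩

theorem Moves.tgt_injOn {G : SimpleGraph V} {K : ℕ} {N : Finset A} {l : List A}
    {S S' : Tables A V} (h : Moves G K N l S S') (htgt : Set.InjOn S.tgt N) :
    Set.InjOn S'.tgt N := by
  obtain ⟨σ, hσ, ht, -⟩ := h.exists_perm
  intro a ha b hb hab
  have key : ∀ c, S'.tgt c = S.tgt (σ.symm c) ∧ (c ∈ N → σ.symm c ∈ N) := fun c =>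
    ⟨by rw [← ht, Equiv.apply_symm_apply], fun hc => by rwa [← hσ, Equiv.apply_symm_apply]⟩
  rw [(key a).1, (key b).1] at hab
  exact σ.symm.injective (htgt ((key a).2 ha) ((key b).2 hb) hab)

/-- Only the agent whose turn it is changes position, so `j ∉ l` keeps every displacement at most
one. -/
theorem Moves.trans {G : SimpleGraph V} {K : ℕ} {N : Finset A} {j : A} {l : List A}
    (hj : j ∉ l) {S₁ S₂ S₃ : Tables A V} (h : Moves G K N [j] S₁ S₂) (h' : Moves G K N l S₂ S₃) :
    Moves G K N (j :: l) S₁ S₃ := by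
  refine ⟨h'.tp_eq.trans h.tp_eq, ?_, h'.pos_inj ∘ h.pos_inj, fun a ha => ?_, fun a => ?_, ?_⟩
  · obtain ⟨σ, h1, h2, h3⟩ := h.exists_perm
    obtain ⟨σ', h1', h2', h3'⟩ := h'.exists_perm
    exact ⟨σ' * σ, by simp [h1, h1'], by simp [h2, h2'], by simp [h3, h3']⟩
  · rw [List.mem_cons, not_or] at ha
    rw [h'.pos_eq a ha.2, h.pos_eq a (by simp [ha.1])]
  · by_cases ha : a = j
    · rw [h'.pos_eq a (ha ▸ hj)]; exact h.dist_le a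
    · rw [← h.pos_eq a (by simp [ha])]; exact h'.dist_le a
  · rcases h.load_lt with rfl | h1
    · exact h'.load_lt
    · rcases h'.load_lt with rfl | h2
      · exact Or.inr h1
      · exact Or.inr (h2.trans h1)

theorem tswapOne_spec {G : SimpleGraph V} {K : ℕ} {N : Finset A} (hK : N.card < K)
    {next : V → V → V} (hnext : IsNextVertexRule G next) {L : List A}
    (hL : ∀ a, a ∈ L ↔ a ∈ N) {S : Tables A V} (htgt : Set.InjOn S.tgt N) {j : A} (hj : j ∈ N) :
    Moves G K N [j] S (tswapOne next L S j) ∧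
      (tswapOne next L S j = S → S.pos j = S.tgt j ∨
        ∃ b ∈ N, S.pos b ≠ S.tgt b ∧ blocker next L S j = some b ∧
          deadlock next L S j = none) := by
  classical
  -- A strict drop of the load rules out `S' = S`, so the second claim is vacuous.
  have of_lt : ∀ {S' : Tables A V}, Moves G K N [j] S S' →
      ∑ a ∈ N, load G K (S'.pos a) (S'.tgt a) < ∑ a ∈ N, load G K (S.pos a) (S.tgt a) →
      ∀ {p : Prop}, Moves G K N [j] S S' ∧ (S' = S → p) := fun h hlt _ =>
    ⟨h, fun heq => absurd hlt (by rw [heq]; exact lt_irrefl _)⟩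
  unfold tswapOne
  by_cases hat : S.pos j = S.tgt j
  · rw [if_pos hat]
    exact ⟨Moves.refl _ _ _ _ _, fun _ => Or.inl hat⟩
  rw [if_neg hat]
  obtain ⟨hadj, hdist⟩ := hnext _ _ hat
  cases hocc : occupant L S (next (S.pos j) (S.tgt j)) with
  | none =>
    simp only [hocc]
    have hfree : ∀ a ∈ N, S.pos a ≠ next (S.pos j) (S.tgt j) := by
      intro a ha heq
      have := List.find?_eq_none.1 hocc a ((hL a).2 ha)
      simp [heq] at this
    set S' : Tables A V :=
      { S with pos := Function.update S.pos j (next (S.pos j) (S.tgt j)) } with hS'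
    have pos_self : S'.pos j = next (S.pos j) (S.tgt j) := by simp [hS']
    have pos_ne : ∀ a, a ≠ j → S'.pos a = S.pos a := fun a ha => by simp [hS', ha]
    have hlt : ∑ a ∈ N, load G K (S'.pos a) (S'.tgt a) <
        ∑ a ∈ N, load G K (S.pos a) (S.tgt a) := by
      refine sum_load_lt_of_dist_lt hK (Finset.sum_lt_sum (fun a _ => ?_) ⟨j, hj, ?_⟩)
      · by_cases ha : a = j
        · rw [ha, pos_self]
          change G.dist _ (S.tgt j) ≤ _
          omega
        · rw [pos_ne a ha]
      · rw [pos_self]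
        change G.dist _ (S.tgt j) < _
        omega
    refine of_lt (S' := S') ⟨rfl, ⟨1, by simp, fun _ => rfl, fun _ => rfl⟩, fun hpos a ha b hb hab => ?_,
      fun a ha => pos_ne a (by simpa using ha), fun a => ?_, Or.inr hlt⟩ hlt
    · by_cases haj : a = j <;> by_cases hbj : b = j
      · rw [haj, hbj]
      · rw [haj, pos_self, pos_ne b hbj] at hab
        exact absurd hab.symm (hfree b hb)
      · rw [hbj, pos_self, pos_ne a haj] at hab
        exact absurd hab (hfree a ha)
      · rw [pos_ne a haj, pos_ne b hbj] at hab
        exact hpos ha hb hab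
    · by_cases ha : a = j
      · rw [ha, pos_self]; exact (SimpleGraph.dist_eq_one_iff_adj.2 hadj).le
      · rw [pos_ne a ha, SimpleGraph.dist_self]; exact Nat.zero_le _
  | some b =>
    simp only [hocc]
    obtain ⟨hbL, hbpos⟩ := mem_of_occupant hocc
    have hbN := (hL b).1 hbL
    by_cases hb : next (S.pos j) (S.tgt j) = S.tgt b
    · rw [if_pos hb]
      have hlt := sum_load_swap_lt K hnext hj hbN htgt hat hbpos (hbpos.trans hb)
      refine of_lt (Moves.permute (fun a => ?_) hlt) hlt
      rw [Equiv.swap_apply_def]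
      split_ifs with h1 h2
      · simp [h1, hj, hbN]
      · simp [h2, hj, hbN]
      · rfl
    · rw [if_neg hb]
      cases hdead : deadlock next L S j with
      | none =>
        refine ⟨Moves.refl _ _ _ _ _, fun _ => Or.inr ⟨b, hbN, hbpos ▸ hb, ?_, rfl⟩⟩
        rw [blocker, if_neg hat, hocc]
      | some D =>
        simp only
        obtain ⟨hjD, hD⟩ := formPerm_of_followTo hdead
        have hDN : ∀ a ∈ D, a ∈ N := fun a ha => by
          obtain ⟨c, hc⟩ : ∃ c, D.formPerm c = a := D.formPerm.surjective a
          have hcD : c ∈ D := List.formPerm_mem_iff_mem.1 (hc ▸ ha)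
          exact (hL a).1 (hc ▸ (blocker_eq_some (hD c hcD)).1)
        have hσ : ∀ a, D.formPerm a ∈ N ↔ a ∈ N := fun a => by
          by_cases ha : a ∈ D
          · simp [hDN a ha, hDN _ (List.formPerm_apply_mem_of_mem ha)]
          · rw [List.formPerm_apply_of_notMem ha]
        have hlt := sum_load_permute_lt hK hnext hσ (S := S) hj fun a ha => by
          have haD : a ∈ D := by
            rcases ha with ha | rfl
            · exact List.mem_of_formPerm_apply_ne ha
            · exact hjD
          exact (blocker_eq_some (hD a haD)).2
        exact of_lt (Moves.permute hσ hlt) hlt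

theorem foldl_tswapOne_spec {G : SimpleGraph V} {K : ℕ} {N : Finset A} (hK : N.card < K)
    {next : V → V → V} (hnext : IsNextVertexRule G next) {L : List A}
    (hL : ∀ a, a ∈ L ↔ a ∈ N) (l : List A) (hl : ∀ a ∈ l, a ∈ N) (hnd : l.Nodup)
    {S : Tables A V} (htgt : Set.InjOn S.tgt N) :
    Moves G K N l S (l.foldl (tswapOne next L) S) ∧
      (l.foldl (tswapOne next L) S = S → ∀ j ∈ l, S.pos j = S.tgt j ∨
        ∃ b ∈ N, S.pos b ≠ S.tgt b ∧ blocker next L S j = some b ∧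
          deadlock next L S j = none) := by
  induction l generalizing S with
  | nil => exact ⟨Moves.refl _ _ _ _ _, fun _ => by simp⟩
  | cons j l ih =>
    rw [List.nodup_cons] at hnd
    obtain ⟨h1, h2⟩ := tswapOne_spec hK hnext hL htgt (hl j List.mem_cons_self)
    obtain ⟨h3, h4⟩ := ih (fun a ha => hl a (List.mem_cons_of_mem _ ha)) hnd.2
      (h1.tgt_injOn htgt)
    rw [List.foldl_cons]
    refine ⟨h1.trans hnd.1 h3, fun heq => ?_⟩
    -- The load never rises and drops at every change, so passes cannot cancel each other.
    have hsame : tswapOne next L S j = S := by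
      rcases h1.load_lt with h | h
      · exact h
      · rcases h3.load_lt with h' | h'
        · exact h'.symm.trans heq
        · rw [heq] at h'
          exact absurd (h.trans h') (lt_irrefl _)
    rw [hsame] at h4 heq
    intro a ha
    rcases List.mem_cons.1 ha with rfl | ha
    · exact h2 hsame
    · exact h4 heq a ha

/-- If the second loop has no effect, then all agents of the subgroup are at their targets. -/
theorem atTarget_of_foldl_tswapOne_eq {G : SimpleGraph V} {N : Finset A}
    {next : V → V → V} (hnext : IsNextVertexRule G next) {L : List A}
    (hL : ∀ a, a ∈ L ↔ a ∈ N) (hnd : L.Nodup) {S : Tables A V} (htgt : Set.InjOn S.tgt N)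
    (heq : L.foldl (tswapOne next L) S = S) {j : A} (hj : j ∈ N) : S.pos j = S.tgt j := by
  classical
  have h := (foldl_tswapOne_spec (Nat.lt_succ_self N.card) hnext hL L (fun a => (hL a).1) hnd
    htgt).2 heq
  by_contra hne
  set B := N.filter fun a => S.pos a ≠ S.tgt a with hB
  have hcard : B.card ≤ L.length := by
    rw [← List.toFinset_card_of_nodup hnd]
    refine Finset.card_le_card fun a ha => ?_
    rw [List.mem_toFinset, hL]
    exact (Finset.mem_filter.1 ha).1
  -- The blocker maps the unsettled agents to themselves and so has a cycle, although none of them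
  -- detects a deadlock.
  have hstuck : ∀ a ∈ B, ∃ b ∈ B, blocker next L S a = some b ∧ deadlock next L S a = none := by
    intro a ha
    rw [hB, Finset.mem_filter] at ha
    rcases h a ((hL a).2 ha.1) with h1 | ⟨b, h1, h2, h3⟩
    · exact absurd h1 ha.2
    · exact ⟨b, Finset.mem_filter.2 ⟨h1, h2⟩, h3⟩
  obtain ⟨a, ha, hdead⟩ := exists_followTo_ne_none (f := blocker next L S)
    ⟨j, Finset.mem_filter.2 ⟨hj, hne⟩⟩
    (fun a ha => (hstuck a ha).imp fun b hb => ⟨hb.1, hb.2.1⟩) hcard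
  obtain ⟨b, -, -, hnone⟩ := hstuck a ha
  exact hdead hnone


/-! ### One call of TP-UPDATE -/

theorem tpUpdate_spec {P : Finset ℕ} {T : Finset V} {N : Finset A} {G : SimpleGraph V} {K : ℕ}
    (hK : N.card < K) {next : V → V → V} (hnext : IsNextVertexRule G next)
    {closest : V → Finset V → V} (hclosest : IsClosestRule G closest) (hPT : P.card ≤ T.card)
    {S : Tables A V} (h : Consistent P T N S) :
    ∃ S₁ S₂, tpUpdate T next closest N S = some S₂ ∧ Consistent P T N S₁ ∧ Resolves N S S₁ ∧
      (∀ j ∈ N, S₁.tp (S₁.tgt j) = S.prio j) ∧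
      Moves G K N (sortByPriority N S.prio) S₁ S₂ ∧
      (S₂ = S₁ → ∀ j ∈ N, S₁.pos j = S₁.tgt j) := by
  obtain ⟨S₁, h1, h2, h3, h4⟩ := foldlM_resolveOne_spec hclosest hPT (sortByPriority N S.prio) ∅
    (fun j => mem_sortByPriority.1) (pairwise_sortByPriority h.prio_inj) (by simp) (by simp) h
    (Resolves.refl N S) (by simp)
  have hrec : ∀ j ∈ N, S₁.tp (S₁.tgt j) = S.prio j := fun j hj =>
    h4 j (Or.inr (mem_sortByPriority.2 hj))
  -- Agents with a common target would share the priority recorded there.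
  have htgt : Set.InjOn S₁.tgt N := fun a ha b hb hab => by
    have := hrec a ha
    rw [hab, hrec b hb, Nat.cast_inj] at this
    exact h.prio_inj ha hb this.symm
  exact ⟨S₁, _, by simp only [tpUpdate, h1, Option.map_some], h2, h3, hrec,
    (foldl_tswapOne_spec hK hnext (fun a => mem_sortByPriority) _ (fun a => mem_sortByPriority.1)
      (nodup_sortByPriority _ _) htgt).1,
    fun heq j hj => atTarget_of_foldl_tswapOne_eq hnext (fun a => mem_sortByPriority)
      (nodup_sortByPriority _ _) htgt heq hj⟩

/-! ### Connected subgroups partition the agents -/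

section Subgroup

variable [Fintype A] {G : SimpleGraph V} {k : ℕ} {c : A → AgentState V}

theorem self_mem_subgroup (i : A) : i ∈ subgroup G k c i := by
  classical
  simp [subgroup, Relation.ReflTransGen.refl]

theorem subgroup_eq_of_mem {i j : A} (h : j ∈ subgroup G k c i) :
    subgroup G k c j = subgroup G k c i := by
  classical
  have hij : Relation.ReflTransGen (fun a b => G.dist (c a).pos (c b).pos ≤ k) i j := by
    simpa [subgroup] using h
  have : Std.Symm fun a b => G.dist (c a).pos (c b).pos ≤ k :=
    ⟨fun a b hab => by rwa [SimpleGraph.dist_comm]⟩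
  have hji := Relation.ReflTransGen.stdSymm.symm _ _ hij
  ext a
  simp only [subgroup, Finset.mem_filter, Finset.mem_univ, true_and]
  exact ⟨hij.trans, hji.trans⟩

theorem subgroup_eq_of_dist_le {i j : A} (h : G.dist (c i).pos (c j).pos ≤ k) :
    subgroup G k c j = subgroup G k c i := by
  classical
  refine subgroup_eq_of_mem ?_
  simp only [subgroup, Finset.mem_filter, Finset.mem_univ, true_and]
  exact Relation.ReflTransGen.single h

theorem sum_subgroup (w : A → ℕ) :
    ∑ i, w i = open Classical in
      ∑ N ∈ Finset.univ.image (subgroup G k c), ∑ i ∈ N, w i := by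
  classical
  rw [← Finset.sum_fiberwise_of_maps_to (t := Finset.univ.image (subgroup G k c))
    (g := subgroup G k c) (fun i hi => Finset.mem_image_of_mem _ hi)]
  refine Finset.sum_congr (by congr!) fun N hN => Finset.sum_congr ?_ fun _ _ => rfl
  obtain ⟨i, -, rfl⟩ := Finset.mem_image.1 hN
  ext j
  simp only [Finset.mem_filter, Finset.mem_univ, true_and]
  exact ⟨fun h => h ▸ self_mem_subgroup j, subgroup_eq_of_mem⟩

end Subgroup

/-! ### The global invariant -/

/-- The invariant of TP-SWAP: `P` is the set of all priorities.  The last two properties say that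
every record of a priority `q` other than the most recent one is known to be outdated wherever a
more recent record of `q` is known. -/
structure Invariant (P : Finset ℕ) (T : Finset V) (c : A → AgentState V) : Prop where
  pos_inj : Function.Injective fun i => (c i).pos
  prio_inj : Function.Injective fun i => (c i).prio
  prio_mem : ∀ i, (c i).prio ∈ P
  tgt_mem : ∀ i, (c i).tgt ∈ T
  le_tp : ∀ i, ((c i).prio : WithBot ℕ) ≤ (c i).tp (c i).tgt
  tp_mem : ∀ i (τ : V) (q : ℕ), (c i).tp τ = q → q ∈ P ∧ τ ∈ T
  outdated : ∀ i i' (τ τ' : V) (q : ℕ), τ ≠ τ' → (c i).tp τ = q → (c i').tp τ' = q →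
    (q : WithBot ℕ) < (c i).tp τ' ∨ (q : WithBot ℕ) < (c i').tp τ
  eq_tgt_or : ∀ i i' (τ : V), (c i').tp τ = (c i).prio →
    τ = (c i).tgt ∨ ((c i).prio : WithBot ℕ) < (c i).tp τ

theorem initial_invariant {P : Finset ℕ} {T : Finset V} {s τ₀ : A → V}
    (hs : Function.Injective s) (hτ₀ : ∀ i, τ₀ i ∈ T) {pr₀ : A → ℕ}
    (hpr₀ : Function.Injective pr₀) (hP : ∀ i, pr₀ i ∈ P) :
    Invariant P T (initial s τ₀ pr₀) := by
  classical
  have htp : ∀ i (τ : V) (q : ℕ), (initial s τ₀ pr₀ i).tp τ = q → q = pr₀ i ∧ τ = τ₀ i := by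
    intro i τ q h
    by_cases hτ : τ = τ₀ i
    · simp only [initial, hτ, Function.update_self, Nat.cast_inj] at h
      exact ⟨h.symm, hτ⟩
    · simp [initial, hτ] at h
  refine ⟨hs, hpr₀, hP, hτ₀, fun i => by simp [initial], fun i τ q h => ?_,
    fun i i' τ τ' q hne h h' => ?_, fun i i' τ h => ?_⟩
  · obtain ⟨rfl, rfl⟩ := htp i τ q h
    exact ⟨hP i, hτ₀ i⟩
  · obtain ⟨hq, rfl⟩ := htp i τ q h
    obtain ⟨hq', rfl⟩ := htp i' τ' q h'
    exact absurd (congrArg τ₀ (hpr₀ (hq.symm.trans hq'))) hne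
  · obtain ⟨hq, rfl⟩ := htp i' τ _ h
    exact Or.inl (congrArg τ₀ (hpr₀ hq).symm)

theorem le_gather_tp (c : A → AgentState V) {N : Finset A} {i : A} (hi : i ∈ N) (τ : V) :
    (c i).tp τ ≤ (gather c N).tp τ :=
  Finset.le_sup (f := fun j => (c j).tp τ) hi

theorem exists_tp_eq_of_gather {c : A → AgentState V} {N : Finset A} {τ : V} {q : ℕ}
    (h : (gather c N).tp τ = q) : ∃ i ∈ N, (c i).tp τ = q := by
  rcases N.eq_empty_or_nonempty with rfl | hN
  · simp [gather] at h
  · obtain ⟨i, hi, heq⟩ := Finset.exists_mem_eq_sup N hN fun j => (c j).tp τ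
    exact ⟨i, hi, heq.symm.trans h⟩

theorem Invariant.gather_consistent {P : Finset ℕ} {T : Finset V} {c : A → AgentState V}
    (h : Invariant P T c) (N : Finset A) : Consistent P T N (gather c N) := by
  refine ⟨h.prio_inj.injOn, fun j _ => h.prio_mem j, fun j _ => h.tgt_mem j,
    fun j hj => (h.le_tp j).trans (le_gather_tp c hj _), fun τ q hq => ?_,
    fun τ τ' q hq hq' => ?_, fun j hj τ hτ => ?_⟩
  · obtain ⟨i, -, hi⟩ := exists_tp_eq_of_gather hq
    exact h.tp_mem i τ q hi
  · by_contra hne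
    obtain ⟨i, hiN, hi⟩ := exists_tp_eq_of_gather hq
    obtain ⟨i', hiN', hi'⟩ := exists_tp_eq_of_gather hq'
    rcases h.outdated i i' τ τ' q hne hi hi' with h1 | h1
    · exact absurd (h1.trans_le (le_gather_tp c hiN τ')) (by rw [hq']; exact lt_irrefl _)
    · exact absurd (h1.trans_le (le_gather_tp c hiN' τ)) (by rw [hq]; exact lt_irrefl _)
  · obtain ⟨i, -, hi⟩ := exists_tp_eq_of_gather hτ
    refine (h.eq_tgt_or j i τ hi).resolve_right fun h1 => ?_
    exact absurd (h1.trans_le (le_gather_tp c hj τ)) (by rw [hτ]; exact lt_irrefl _)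

/-- The invariant survives when every agent adopts the table computed by its subgroup, and targets
and priorities are permuted within the subgroups. -/
theorem Invariant.step {P : Finset ℕ} {T : Finset V} {c c' : A → AgentState V}
    (h : Invariant P T c) {g : A → Finset A}
    (hg : ∀ i j, j ∈ g i → g j = g i) {S : Finset A → Tables A V}
    (hS : ∀ i, Consistent P T (g i) (S (g i))) (hR : ∀ i, Resolves (g i) (gather c (g i)) (S (g i)))
    {π : A → A} (hπ : Function.Injective π) (hπg : ∀ i, π i ∈ g i)
    (htgt : ∀ i, (c' i).tgt = (S (g i)).tgt (π i)) (hprio : ∀ i, (c' i).prio = (c (π i)).prio)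
    (htp : ∀ i, (c' i).tp = (S (g i)).tp) (hpos : Function.Injective fun i => (c' i).pos) :
    Invariant P T c' := by
  have hSprio : ∀ i j, (S (g i)).prio j = (c j).prio := fun i j => by rw [(hR i).prio_eq]; rfl
  have hinj : Function.Injective fun i => (c' i).prio := fun i j hij => by
    simp only [hprio] at hij
    exact hπ (h.prio_inj hij)
  have hle : ∀ i, ∀ j ∈ g i, ∀ τ, (c j).tp τ ≤ (S (g i)).tp τ := fun i j hj τ =>
    (le_gather_tp c hj τ).trans ((hR i).tp_le τ)
  have horigin : ∀ i (τ : V) (q : ℕ), (S (g i)).tp τ = q → (∃ j ∈ g i, (c j).tp τ = q) ∨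
      ∃ j ∈ g i, (S (g i)).tgt j = τ ∧ (c j).prio = q ∧
        (q : WithBot ℕ) < (S (g i)).tp (c j).tgt := by
    intro i τ q hq
    rcases (hR i).tp_eq_or τ with h1 | ⟨j, hj, h1, h2, h3⟩
    · exact Or.inl (exists_tp_eq_of_gather (h1.symm.trans hq))
    · rw [hq, Nat.cast_inj] at h2
      rw [← h2] at h3
      exact Or.inr ⟨j, hj, h1, h2.symm, h3⟩
  -- An agent's own table dominates all old records of its priority.
  have hold : ∀ i, ∀ j ∈ g i, ∀ i' (τ : V), (c i').tp τ = (c j).prio →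
      τ = (S (g i)).tgt j ∨ ((c j).prio : WithBot ℕ) < (S (g i)).tp τ := by
    intro i j hj i' τ hτ
    rcases h.eq_tgt_or j i' τ hτ with rfl | h1
    · rcases (hR i).tgt_eq_or j with h2 | h2
      · exact Or.inl h2.symm
      · exact Or.inr h2
    · exact Or.inr (h1.trans_le (hle i j hj τ))
  refine ⟨hpos, hinj, fun i => hprio i ▸ h.prio_mem _,
    fun i => htgt i ▸ (hS i).tgt_mem _ (hπg i), fun i => ?_, fun i τ q hq => ?_,
    fun i i' τ τ' q hne hq hq' => ?_, fun i i' τ hq => ?_⟩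
  · rw [htp, htgt, hprio, ← hSprio i]
    exact (hS i).le_tp _ (hπg i)
  · rw [htp] at hq
    exact (hS i).tp_mem τ q hq
  · rw [htp] at hq hq' ⊢
    rw [htp i']
    -- Each of the two records is either inherited or new. Two inherited ones fall under the old
    -- invariant, and one new record under `hold`; two new ones stem from the same agent, hence from
    -- the same subgroup and target.
    rcases horigin i τ q hq with ⟨j, hj, h1⟩ | ⟨j, hj, h1, h2, h3⟩ <;>
      rcases horigin i' τ' q hq' with ⟨j', hj', h1'⟩ | ⟨j', hj', h1', h2', h3'⟩
    · exact (h.outdated j j' τ τ' q hne h1 h1').imp (fun h4 => h4.trans_le (hle i j hj τ'))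
        fun h4 => h4.trans_le (hle i' j' hj' τ)
    · rw [← h2'] at h1 ⊢
      refine Or.inr ((hold i' j' hj' j τ h1).resolve_left fun h4 => hne (h4.trans h1'))
    · rw [← h2] at h1' ⊢
      exact Or.inl ((hold i j hj j' τ' h1').resolve_left fun h4 => hne (h1.symm.trans h4.symm))
    · have hjj : j = j' := h.prio_inj (h2.trans h2'.symm)
      subst hjj
      rw [← hg i j hj, hg i' j hj'] at h1
      exact absurd (h1.symm.trans h1') hne
  · rw [htp] at hq ⊢
    rw [hprio] at hq ⊢
    rw [htgt]
    rcases horigin i' τ _ hq with ⟨j, hj, h1⟩ | ⟨j, hj, h1, h2, h3⟩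
    · exact hold i _ (hπg i) j τ h1
    · have hjj : j = π i := h.prio_inj h2
      subst hjj
      rw [← hg i' _ hj, hg i _ (hπg i)] at h1
      exact Or.inl h1.symm

/-! ### Progress and termination -/

/-- The number of ways in which the tables can still increase. -/
noncomputable def slack [Fintype A] (P : Finset ℕ) (T : Finset V) (c : A → AgentState V) : ℕ :=
  open Classical in ∑ i, ∑ τ ∈ T, (P.filter fun p : ℕ => (c i).tp τ < (p : WithBot ℕ)).card

theorem slack_lt_or_tp_eq [Fintype A] {P : Finset ℕ} {T : Finset V} {c c' : A → AgentState V}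
    (hmem : ∀ i (τ : V) (q : ℕ), (c' i).tp τ = q → q ∈ P ∧ τ ∈ T)
    (hle : ∀ i τ, (c i).tp τ ≤ (c' i).tp τ) :
    slack P T c' < slack P T c ∨ ∀ i, (c' i).tp = (c i).tp := by
  classical
  by_cases heq : ∀ i, (c' i).tp = (c i).tp
  · exact Or.inr heq
  left
  push Not at heq
  obtain ⟨i, hi⟩ := heq
  obtain ⟨τ, hτ⟩ := Function.ne_iff.1 hi
  have hlt : (c i).tp τ < (c' i).tp τ := lt_of_le_of_ne (hle i τ) hτ.symm
  obtain ⟨q, hq⟩ := WithBot.ne_bot_iff_exists.1 (ne_bot_of_gt hlt)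
  obtain ⟨hqP, hτT⟩ := hmem i τ q hq.symm
  have hsub : ∀ i τ, (P.filter fun p : ℕ => (c' i).tp τ < (p : WithBot ℕ)) ⊆
      P.filter fun p : ℕ => (c i).tp τ < (p : WithBot ℕ) := fun i τ =>
    Finset.monotone_filter_right _ fun p _ hp => (hle i τ).trans_lt hp
  unfold slack
  refine Finset.sum_lt_sum (fun j _ => Finset.sum_le_sum fun σ _ =>
    Finset.card_le_card (by convert hsub j σ)) ⟨i, Finset.mem_univ i,
    Finset.sum_lt_sum (fun σ _ => Finset.card_le_card (by convert hsub i σ))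
    ⟨τ, hτT, Finset.card_lt_card ?_⟩⟩
  rw [Finset.ssubset_iff_of_subset (by convert hsub i τ)]
  refine ⟨q, ?_, ?_⟩
  · rw [← hq] at hlt
    simp only [Finset.mem_filter]
    exact ⟨hqP, hlt⟩
  · simp only [Finset.mem_filter, not_and]
    intro _
    rw [← hq]
    exact lt_irrefl _

theorem exists_globalStep [Fintype A] {P : Finset ℕ} {T : Finset V} {G : SimpleGraph V}
    (hG : G.Connected) {k : ℕ} (hk : 2 ≤ k) {next : V → V → V} (hnext : IsNextVertexRule G next)
    {closest : V → Finset V → V} (hclosest : IsClosestRule G closest) (hPT : P.card ≤ T.card)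
    {c : A → AgentState V} (h : Invariant P T c) :
    ∃ c', globalStep G k T next closest c = some c' ∧ Invariant P T c' ∧
      ((c' = c ∧ ∀ i, (c i).pos = (c i).tgt) ∨ slack P T c' < slack P T c ∨
        slack P T c' = slack P T c ∧
          ∑ i, load G (Fintype.card A + 1) (c' i).pos (c' i).tgt <
            ∑ i, load G (Fintype.card A + 1) (c i).pos (c i).tgt) := by
  classical
  choose S₁ S₂ hupd hcons hres hrec hmov hfix using fun N : Finset A =>
    tpUpdate_spec (Nat.lt_succ_of_le (Finset.card_le_univ N)) hnext hclosest hPT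
      (h.gather_consistent N)
  choose σ hσN hσt hσp using fun N => (hmov N).exists_perm
  set g := subgroup G k c with hgdef
  have hself : ∀ i, i ∈ g i := self_mem_subgroup
  have hg : ∀ i j, j ∈ g i → g j = g i := fun i j => subgroup_eq_of_mem
  set c' : A → AgentState V := fun i =>
    { pos := (S₂ (g i)).pos i, tgt := (S₂ (g i)).tgt i, prio := (S₂ (g i)).prio i,
      tp := (S₂ (g i)).tp } with hc'
  have hagent : ∀ i, agentStep G k T next closest c i = some (c' i) := fun i => by
    simp only [agentStep, ← hgdef, hupd, Option.map_some, hc']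
  have hstep : globalStep G k T next closest c = some c' := by
    have hsome : ∀ i, (agentStep G k T next closest c i).isSome := fun i => by simp [hagent i]
    rw [globalStep, dif_pos hsome]
    simp [hagent]
  have htp : ∀ i, (c' i).tp = (S₁ (g i)).tp := fun i => (hmov (g i)).tp_eq
  set π : A → A := fun i => (σ (g i)).symm i with hπdef
  have hσπ : ∀ i, σ (g i) (π i) = i := fun i => Equiv.apply_symm_apply _ _
  have hπg : ∀ i, π i ∈ g i := fun i => by
    rw [← hσN (g i), hσπ]; exact hself i
  -- Each `π i` stays in the subgroup of `i`, so equal values force equal subgroups and the same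
  -- permutation.
  have hπ : Function.Injective π := fun i j hij => by
    have hgg : g i = g j := by rw [← hg i _ (hπg i), hij, hg j _ (hπg j)]
    rw [← hσπ i, ← hσπ j, hij, hgg]
  have htgt : ∀ i, (c' i).tgt = (S₁ (g i)).tgt (π i) := fun i => by
    rw [← hσt (g i), hσπ]
  have hprio : ∀ i, (c' i).prio = (c (π i)).prio := fun i => by
    have := hσp (g i) (π i)
    rw [hσπ, (hres (g i)).prio_eq] at this
    exact this
  have hS₁pos : ∀ N i, (S₁ N).pos i = (c i).pos := fun N i => by rw [(hres N).pos_eq]; rfl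
  have hdist : ∀ i, G.dist (c i).pos (c' i).pos ≤ 1 := fun i => by
    rw [← hS₁pos (g i)]; exact (hmov (g i)).dist_le i
  -- Agents that meet at a vertex were at distance at most `2 ≤ k` before, so they belong to one
  -- subgroup, within which collisions are excluded.
  have hpos : Function.Injective fun i => (c' i).pos := fun i j hij => by
    have hij' : (c' i).pos = (c' j).pos := hij
    have hgg : g j = g i := by
      refine subgroup_eq_of_dist_le ?_
      have h1 := hG.dist_triangle (u := (c i).pos) (v := (c' i).pos) (w := (c j).pos)
      have h2 := hdist i
      have h3 := hdist j
      rw [← hij', SimpleGraph.dist_comm] at h3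
      omega
    refine (hmov (g i)).pos_inj ?_ (hself i) (hgg ▸ hself j) ?_
    · rw [(hres _).pos_eq]; exact h.pos_inj.injOn
    · simpa [hc', hgg] using hij'
  have hinv : Invariant P T c' := h.step hg (fun i => hcons (g i)) (fun i => hres (g i)) hπ
    hπg htgt hprio htp hpos
  refine ⟨c', hstep, hinv, ?_⟩
  have hle₁ : ∀ i τ, (c i).tp τ ≤ (gather c (g i)).tp τ := fun i τ => le_gather_tp c (hself i) τ
  have hle₂ : ∀ i τ, (gather c (g i)).tp τ ≤ (c' i).tp τ := fun i τ => by
    rw [htp]; exact (hres (g i)).tp_le τ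
  rcases slack_lt_or_tp_eq hinv.tp_mem (fun i τ => (hle₁ i τ).trans (hle₂ i τ)) with hlt | htpeq
  · exact Or.inr (Or.inl hlt)
  -- The merged table lies between an agent's old and new tables, which agree; thus the first loop
  -- left it unchanged.
  have htgt₁ : ∀ i, ∀ j ∈ g i, (S₁ (g i)).tgt j = (c j).tgt := fun i j hj => by
    refine (h.gather_consistent (g i)).tgt_eq (funext fun τ => ?_) (hrec (g i)) hj
    refine le_antisymm ?_ ((hres (g i)).tp_le τ)
    rw [← htp, htpeq]
    exact hle₁ i τ
  have hslack : slack P T c' = slack P T c := by simp only [slack, htpeq]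
  by_cases hall : ∀ i, S₂ (g i) = S₁ (g i)
  · left
    refine ⟨funext fun i => ?_, fun i => ?_⟩
    · have h1 : (c' i).pos = (c i).pos := by simp only [hc', hall, hS₁pos]
      have h2 : (c' i).tgt = (c i).tgt := by simp only [hc', hall, htgt₁ i i (hself i)]
      have h3 : (c' i).prio = (c i).prio := by
        simp only [hc', hall, (hres (g i)).prio_eq]
        rfl
      have h4 := htpeq i
      cases hci : c i
      cases hci' : c' i
      simp_all
    · have := hfix (g i) (hall i) i (hself i)
      rwa [hS₁pos, htgt₁ i i (hself i)] at this
  · right; right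
    refine ⟨hslack, ?_⟩
    push Not at hall
    obtain ⟨i₀, hi₀⟩ := hall
    rw [sum_subgroup (G := G) (k := k) (c := c),
      sum_subgroup (G := G) (k := k) (c := c) fun i => load G _ (c i).pos (c i).tgt]
    have hnew : ∀ i, ∑ j ∈ g i, load G (Fintype.card A + 1) (c' j).pos (c' j).tgt =
        ∑ j ∈ g i, load G (Fintype.card A + 1) ((S₂ (g i)).pos j) ((S₂ (g i)).tgt j) := fun i =>
      Finset.sum_congr rfl fun j hj => by simp only [hc', hg i j hj]
    have hold : ∀ i, ∑ j ∈ g i, load G (Fintype.card A + 1) (c j).pos (c j).tgt =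
        ∑ j ∈ g i, load G (Fintype.card A + 1) ((S₁ (g i)).pos j) ((S₁ (g i)).tgt j) := fun i =>
      Finset.sum_congr rfl fun j hj => by rw [hS₁pos, htgt₁ i j hj]
    refine Finset.sum_lt_sum (fun N hN => ?_)
      ⟨g i₀, Finset.mem_image_of_mem _ (Finset.mem_univ _), ?_⟩
    · obtain ⟨i, -, rfl⟩ := Finset.mem_image.1 hN
      rw [← hgdef, hnew, hold]
      rcases (hmov (g i)).load_lt with h1 | h1
      · rw [h1]
      · exact h1.le
    · rw [hnew, hold]
      exact (hmov (g i₀)).load_lt.resolve_left hi₀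

/-- From a configuration that satisfies the invariant, iterating the global step leads to a
configuration that satisfies it too, is a fixed point, and has all agents at their targets. -/
theorem exists_run_fixed [Fintype A] {P : Finset ℕ} {T : Finset V} {G : SimpleGraph V}
    (hG : G.Connected) {k : ℕ} (hk : 2 ≤ k) {next : V → V → V} (hnext : IsNextVertexRule G next)
    {closest : V → Finset V → V} (hclosest : IsClosestRule G closest) (hPT : P.card ≤ T.card)
    {s τ₀ : A → V} {pr₀ : A → ℕ} (t : ℕ) (c : A → AgentState V) (h : Invariant P T c)
    (hrun : run G k T next closest s τ₀ pr₀ t = some c) :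
    ∃ t₀ c₀, run G k T next closest s τ₀ pr₀ t₀ = some c₀ ∧ Invariant P T c₀ ∧
      globalStep G k T next closest c₀ = some c₀ ∧ ∀ i, (c₀ i).pos = (c₀ i).tgt := by
  have hwf := WellFounded.prod_lex (wellFounded_lt (α := ℕ)) (wellFounded_lt (α := ℕ))
  obtain ⟨m, hm⟩ : ∃ m : ℕ × ℕ, m = (slack P T c,
    ∑ i, load G (Fintype.card A + 1) (c i).pos (c i).tgt) := ⟨_, rfl⟩
  induction m using hwf.induction generalizing t c with
  | _ m ih =>
    obtain ⟨c', hstep, hinv, hcase⟩ := exists_globalStep hG hk hnext hclosest hPT h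
    have hrun' : run G k T next closest s τ₀ pr₀ (t + 1) = some c' := by
      rw [run, hrun]; exact hstep
    rcases hcase with ⟨rfl, hat⟩ | hlt | ⟨heq, hlt⟩
    · exact ⟨t, c', hrun, h, hstep, hat⟩
    · exact ih _ (hm ▸ Prod.Lex.left _ _ hlt) (t + 1) c' hinv hrun' rfl
    · refine ih _ ?_ (t + 1) c' hinv hrun' rfl
      rw [hm, heq]
      exact Prod.Lex.right _ hlt

end TPSwap

theorem theorem1 {A V : Type*} [Fintype A] (G : SimpleGraph V) (hG : G.Connected)
    (T : Finset V) (hT : T.card = Fintype.card A)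
    (k : ℕ) (hk : 2 ≤ k)
    (next : V → V → V) (hnext : TPSwap.IsNextVertexRule G next)
    (closest : V → Finset V → V) (hclosest : TPSwap.IsClosestRule G closest)
    (s : A → V) (hs : Function.Injective s)
    (τ₀ : A → V) (hτ₀ : ∀ i, τ₀ i ∈ T)
    (pr₀ : A → ℕ) (hpr₀ : Function.Injective pr₀) :
    ∃ t₀ : ℕ, ∀ t ≥ t₀, ∃ c : A → TPSwap.AgentState V,
      TPSwap.run G k T next closest s τ₀ pr₀ t = some c ∧
      (∀ i, (c i).pos = (c i).tgt) ∧
      ∀ τ ∈ T, ∃ i, (c i).pos = τ := by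
  classical
  have hPT : (Finset.univ.image pr₀).card ≤ T.card := by
    rw [hT]; exact Finset.card_image_le
  obtain ⟨t₀, c, hrun, hinv, hfix, hat⟩ := TPSwap.exists_run_fixed hG hk hnext hclosest hPT 0 _
    (TPSwap.initial_invariant hs hτ₀ hpr₀ fun i => Finset.mem_image_of_mem _ (Finset.mem_univ i))
    (s := s) (τ₀ := τ₀) (pr₀ := pr₀) rfl
  refine ⟨t₀, fun t ht => ⟨c, ?_, hat, fun τ hτ => ?_⟩⟩
  · induction t, ht using Nat.le_induction with
    | base => exact hrun
    | succ t _ ih => rw [TPSwap.run, ih]; exact hfix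
  · have himage : Finset.univ.image (fun i => (c i).pos) = T := by
      refine Finset.eq_of_subset_of_card_le (fun v hv => ?_) ?_
      · obtain ⟨i, -, rfl⟩ := Finset.mem_image.1 hv
        rw [hat i]
        exact hinv.tgt_mem i
      · rw [Finset.card_image_of_injective _ hinv.pos_inj, hT, Finset.card_univ]
    rw [← himage] at hτ
    obtain ⟨i, -, hi⟩ := Finset.mem_image.1 hτ
    exact ⟨i, hi⟩
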